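/- **Setting.** Let $d,r\ge 0$ be integers. Fix constants $\lambda_k>0$, $p_k,\,q_{k,l,m},\,d_k\in[0,1]$ ($k,l,m\in\mathbb Z^d$), $C_f,C_b\ge 0$ and bilinear maps $B_{k,l,m}:\mathbb C^r\times\mathbb C^r\to\mathbb C^r$ with $|B_{k,l,m}(\chi,\chi')|\le|\chi||\chi'|$ (Euclidean norm). Put $q_k=\sum_{l,m}q_{k,l,m}$ and assume $q_k<\infty$, $p_k+q_k+d_k=1$ for all $k$, and $p_k\to0$, $q_k\to0$ as $|k|\to\infty$. Let $\chi(0)=(\chi_k(0))_{k\in\mathbb Z^d}$ in $\mathbb C^r$ and measurable functions $\gamma_k$ of time with values in $\mathbb C^r$ be given (no boundedness is required), and let $T\ge0$. **The branching tree.** Labels are finite words $\alpha$ over $\{0,1,2\}$; the root is the empty word $\emptyset$, and $(\alpha,i)$ are the potential children of $\alpha$. Attach to the labels independent copies of $(E_\alpha,U_\alpha,(Y_\alpha(k))_{k\in\mathbb Z^d})$, where $E_\alpha$ is exponential of mean $1$, $U_\alpha$ is uniform on $[0,1]$, $Y_\alpha(k)=(Y^{(1)}_\alpha(k),Y^{(2)}_\alpha(k))$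 equals $(l,m)$ with probability $q_{k,l,m}/q_k$ (any fixed law if $q_k=0$), and all these variables are independent. The root sits at $k$ and is born at time $0$. A particle $\alpha$ at position $j$ dies at time $t_\alpha=s_\alpha+\lambda_j^{-1}E_\alpha$, where $s_\alpha$ is its birth time; at its death it flips if $U_\alpha\in[0,p_j]$ (child $(\alpha,0)$ is born, at position $j$), branches if $U_\alpha\in[1-q_j,1]$ (children $(\alpha,1)$, $(\alpha,2)$ are born, at positions $Y^{(1)}_\alpha(j)$, $Y^{(2)}_\alpha(j)$), and dies without offspring otherwise; children are born at time $t_\alpha$. Write $\mathcal T=(k_\alpha,s_\alpha,t_\alpha)_\alpha$ for the resulting tree ($k_\alpha$ is the position of $\alpha$, or a cemetery state $\Delta$ if $\alpha$ is never born), $\mathsf E_k$ for the expectation over it, and $\pi_i(\mathcal T)$ for the tree of descendants of $(i)$ with all times shifted by $-t_\emptyset$. **Evaluation.** Whenever only finitely many particles are born in $[0,t]$ (this has probability $1$), $R_t(\mathcal T)\in\mathbb C^r$ is determined, for $t\ge 0$, by $$R_t(\mathcal T)=\begin{cases}\chi_{k_\emptyset}(0)& t_\emptyset\ge t,\\ \gamma_{k_\emptyset}(t-t_\emptyset)&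 t_\emptyset<t,\ \text{death without offspring at }\emptyset,\\ C_f\,R_{t-t_\emptyset}(\pi_0(\mathcal T))& t_\emptyset<t,\ \text{flip at }\emptyset,\\ C_b\,B_{k_\emptyset,k_{(1)},k_{(2)}}\big(R_{t-t_\emptyset}(\pi_1(\mathcal T)),R_{t-t_\emptyset}(\pi_2(\mathcal T))\big)& t_\emptyset<t,\ \text{branch at }\emptyset.\end{cases}$$ The positive evaluation $\tilde R_t(\mathcal T)\ge0$ is defined by the same formula with the data replaced by $|\chi_k(0)|$, $|\gamma_k|$ and every $B_{k,l,m}$ by the product of real numbers. (On the remaining null set both are set to $0$.) **Comparison system.** A non-negative mild solution on $[0,T]$ of $$\dot{\tilde\chi}_k=\lambda_k\Big[-\tilde\chi_k+C_fp_k\tilde\chi_k+C_b\sum_{l,m\in\mathbb Z^d}q_{k,l,m}\tilde\chi_l\tilde\chi_m+d_k|\gamma_k|\Big],\qquad \tilde\chi_k(0)=|\chi_k(0)|,\tag{1}$$ is a family of measurable functions $\tilde\chi_k:[0,T]\to[0,\infty]$ with, for all $k$ and all $t\in[0,T]$, $$\tilde\chi_k(t)=e^{-\lambda_kt}|\chi_k(0)|+\int_0^t\lambda_ke^{-\lambda_k(t-s)}\Big[C_fp_k\tilde\chi_k(s)+C_b\sum_{l,m}q_{k,l,m}\tilde\chi_l(s)\tilde\chi_m(s)+d_k|\gamma_k(s)|\Big]ds,$$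 integral and sum being taken in $[0,\infty]$ with $0\cdot\infty=0$. It is finite if $\tilde\chi_k(t)<\infty$ for all $k$ and all $t\in[0,T]$. **Theorem.** 1. If $\mathsf E_k[\tilde R_t]<\infty$ for all $t\in[0,T]$ and $k\in\mathbb Z^d$, then $\tilde\chi_k(t)=\mathsf E_k[\tilde R_t]$ is a mild solution of (1) on $[0,T]$, and $t\mapsto\tilde\chi_k(t)$ is continuous on $[0,T]$ for every $k$. 2. Conversely, if (1) has a finite non-negative mild solution on $[0,T]$, then $\mathsf E_k[\tilde R_t]<\infty$ for all $t\in[0,T]$ and $k\in\mathbb Z^d$, and $\mathsf E_k[\tilde R_t]$ is the smallest non-negative mild solution of (1): it is a mild solution, and every non-negative mild solution $v$ of (1) on $[0,T]$ satisfies $\mathsf E_k[\tilde R_t]\le v_k(t)$ for all $k$ and all $t\in[0,T]$. 3. For all $k$ and all $t\ge0$, $\mathsf E_k|R_t|\le\mathsf E_k[\tilde R_t]$ (in $[0,\infty]$), with equality if $|B_{k,l,m}(\chi,\chi')|=|\chi||\chi'|$ for all $k,l,m$ and all $\chi,\chi'\in\mathbb C^r$. -/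

import Mathlib

open MeasureTheory ProbabilityTheory Filter Topology Set
open scoped ENNReal

namespace BranchTree

/-- Fourier modes `k ∈ ℤ^d`. -/
abbrev Mode (d : ℕ) : Type := Fin d → ℤ

/-- The state space `ℂ^r` with its Euclidean norm. -/
abbrev State (r : ℕ) : Type := EuclideanSpace ℂ (Fin r)

/-- The constants of the system of ODEs
`χ_k' = lam_k [-χ_k + Cf p_k χ_k + Cb ∑_{l,m} q_{k,l,m} B_{k,l,m}(χ_l, χ_m) + dd_k γ_k]`,
together with the standing assumptions on them. -/
structure System (d r : ℕ) where
  /-- the rates -/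
  lam : Mode d → ℝ
  /-- the flipping probabilities -/
  p : Mode d → ℝ
  /-- the branching probabilities, by position of the two children -/
  q : Mode d → Mode d → Mode d → ℝ
  /-- the dying probabilities -/
  dd : Mode d → ℝ
  /-- the flipping constant -/
  Cf : ℝ
  /-- the branching constant -/
  Cb : ℝ
  /-- the bilinear operators -/
  B : Mode d → Mode d → Mode d → State r →ₗ[ℂ] State r →ₗ[ℂ] State r
  lam_pos : ∀ k, 0 < lam k
  p_mem : ∀ k, p k ∈ Icc (0 : ℝ) 1
  q_mem : ∀ k l m, q k l m ∈ Icc (0 : ℝ) 1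
  dd_mem : ∀ k, dd k ∈ Icc (0 : ℝ) 1
  Cf_nonneg : 0 ≤ Cf
  Cb_nonneg : 0 ≤ Cb
  norm_B_le : ∀ k l m x y, ‖B k l m x y‖ ≤ ‖x‖ * ‖y‖
  q_summable : ∀ k, Summable fun lm : Mode d × Mode d => q k lm.1 lm.2
  prob_sum : ∀ k, p k + (∑' lm : Mode d × Mode d, q k lm.1 lm.2) + dd k = 1
  /-- `p_k → 0` as `|k| → ∞` (in `ℤ^d` the cofinite filter is `|k| → ∞`) -/
  p_tendsto : Tendsto p cofinite (𝓝 0)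
  /-- `q_k → 0` as `|k| → ∞` -/
  q_tendsto : Tendsto (fun k => ∑' lm : Mode d × Mode d, q k lm.1 lm.2) cofinite (𝓝 0)

/-- Particle labels, finite words over `{0, 1, 2}`. The head of the list is the first letter, so
`[]` is the root, `i :: α` is the label `(i, α)`, and `α ++ [i]` is the child `(α, i)` of `α`. -/
abbrev Label : Type := List (Fin 3)

/-- Marked trees: a position (`none` is the cemetery state), a birth time and a death time for
every label. -/
@[ext] structure Tree (d : ℕ) where
  pos : Label → Option (Mode d)
  birth : Label → ℝ
  death : Label → ℝ

/-- The tree of descendants of the particle `(i)`, with times shifted by the death time of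
the root. -/
def Tree.shift {d : ℕ} (𝒯 : Tree d) (i : Fin 3) : Tree d where
  pos α := 𝒯.pos (i :: α)
  birth α := 𝒯.birth (i :: α) - 𝒯.death []
  death α := 𝒯.death (i :: α) - 𝒯.death []

/-- The labels of the (actual, non-cemetery) particles born in `[0, t]`. -/
def Tree.born {d : ℕ} (𝒯 : Tree d) (t : ℝ) : Set Label :=
  {α | 𝒯.pos α ≠ none ∧ 𝒯.birth α ≤ t}

/-- Evaluation backwards along the tree, followed for at most `n` generations
(with the irrelevant value `0` for what lies beyond). -/
noncomputable def evalApprox {d : ℕ} {V : Type*} [AddCommGroup V] [Module ℝ V]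
    (Cf Cb : ℝ) (B : Mode d → Mode d → Mode d → V → V → V)
    (init : Mode d → V) (force : Mode d → ℝ → V) : ℕ → ℝ → Tree d → V
  | 0, _, _ => 0
  | n + 1, t, 𝒯 =>
    match 𝒯.pos [] with
    | none => 0
    | some k =>
      if t ≤ 𝒯.death [] then init k
      else
        match 𝒯.pos [0], 𝒯.pos [1], 𝒯.pos [2] with
        | none, none, none => force k (t - 𝒯.death [])
        | some _, none, none =>
          Cf • evalApprox Cf Cb B init force n (t - 𝒯.death []) (𝒯.shift 0)
        | none, some l, some m =>
          Cb • B k l m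
            (evalApprox Cf Cb B init force n (t - 𝒯.death []) (𝒯.shift 1))
            (evalApprox Cf Cb B init force n (t - 𝒯.death []) (𝒯.shift 2))
        | _, _, _ => 0

open Classical in
/-- The evaluation operator: if `N = N_{[0,t]}(𝒯)`, the number of particles born in `[0, t]`,
is finite, then the evaluation that follows the tree for `N` generations (which sees the whole
tree up to time `t`); otherwise `0`. See `eval_tree` for the recursive formula it satisfies. -/
noncomputable def eval {d : ℕ} {V : Type*} [AddCommGroup V] [Module ℝ V]
    (Cf Cb : ℝ) (B : Mode d → Mode d → Mode d → V → V → V)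
    (init : Mode d → V) (force : Mode d → ℝ → V) (t : ℝ) (𝒯 : Tree d) : V :=
  if (𝒯.born t).Finite then evalApprox Cf Cb B init force (𝒯.born t).ncard t 𝒯 else 0

/-- The randomness attached to one label `α`: the exponential variable `E_α`, the uniform variable
`U_α` and the offspring positions `k ↦ (Y_α^{(1)}(k), Y_α^{(2)}(k))`. -/
abbrev Mark (d : ℕ) : Type := ℝ × ℝ × (Mode d → Mode d × Mode d)

/-- One mark for every label. -/
abbrev Noise (d : ℕ) : Type := Label → Mark d

namespace System

variable {d r : ℕ} (S : System d r)

/-- The total branching probability `q_k = ∑_{l,m} q_{k,l,m}`. -/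
noncomputable def qTot (k : Mode d) : ℝ := ∑' lm : Mode d × Mode d, S.q k lm.1 lm.2

open Classical in
/-- The law of the positions of the two children of a particle at `k` that branches:
`(l, m)` has probability `q_{k,l,m} / q_k` (and an arbitrary law if `q_k = 0`, when no particle at
`k` ever branches). -/
noncomputable def offspring (k : Mode d) : PMF (Mode d × Mode d) :=
  if h : (∑' lm : Mode d × Mode d, ENNReal.ofReal (S.q k lm.1 lm.2)) ≠ 0 ∧
      (∑' lm : Mode d × Mode d, ENNReal.ofReal (S.q k lm.1 lm.2)) ≠ ∞
  then PMF.normalize (fun lm : Mode d × Mode d => ENNReal.ofReal (S.q k lm.1 lm.2)) h.1 h.2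
  else PMF.pure (k, k)

/-- The law of one mark: an exponential variable of mean one, a uniform variable on `[0, 1]`, and
offspring positions for every mode, all independent. -/
noncomputable def markLaw : Measure (Mark d) :=
  (expMeasure 1).prod ((volume.restrict (Icc (0 : ℝ) 1)).prod
    (Measure.infinitePi fun k => (S.offspring k).toMeasure))

instance : IsProbabilityMeasure S.markLaw := by
  have h1 : IsProbabilityMeasure (expMeasure 1) := isProbabilityMeasure_expMeasure one_pos
  have h2 : IsProbabilityMeasure ((volume : Measure ℝ).restrict (Icc (0 : ℝ) 1)) :=
    ⟨by simp⟩
  unfold markLaw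
  infer_instance

/-- The law of the noise: independent identically distributed marks at all labels. -/
noncomputable def noiseLaw : Measure (Noise d) := Measure.infinitePi fun _ : Label => S.markLaw

/-- The position of the potential child `i` of a particle at `k` with mark `x`: `0` is the flip,
`1` and `2` are the two children of a branching. -/
def childPos (k : Mode d) (x : Mark d) (i : Fin 3) : Mode d :=
  if i = 0 then k else if i = 1 then (x.2.2 k).1 else (x.2.2 k).2

/-- Whether the potential child `i` of a particle at `k` with mark `x` is realised. -/
def childAlive (k : Mode d) (x : Mark d) (i : Fin 3) : Prop :=
  if i = 0 then x.2.1 ∈ Icc 0 (S.p k) else x.2.1 ∈ Icc (1 - S.qTot k) 1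

/-- The position of the particle `α` in the tree of all potential particles, rooted at `k`;
see `hatPos_append` for the recursion over the generations. -/
def hatPos : Mode d → Noise d → Label → Mode d
  | k, _, [] => k
  | k, ω, i :: α => hatPos (childPos k (ω []) i) (fun β => ω (i :: β)) α

/-- All ancestors of `α`, and `α` itself, are realised; see `realised_append`. -/
def Realised : Mode d → Noise d → Label → Prop
  | _, _, [] => True
  | k, ω, i :: α => S.childAlive k (ω []) i ∧
      Realised (childPos k (ω []) i) (fun β => ω (i :: β)) α

/-- Birth times: the root is born at time `0`, every other particle when its parent dies;
see `birthTime_append`. -/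
noncomputable def birthTime : Mode d → Noise d → Label → ℝ
  | _, _, [] => 0
  | k, ω, i :: α => (S.lam k)⁻¹ * (ω []).1 +
      birthTime (childPos k (ω []) i) (fun β => ω (i :: β)) α

/-- Death times: a particle at `k` lives for an exponential time of rate `lam k`. -/
noncomputable def deathTime (k : Mode d) (ω : Noise d) (α : Label) : ℝ :=
  S.birthTime k ω α + (S.lam (hatPos k ω α))⁻¹ * (ω α).1

open Classical in
/-- The random branching tree rooted at `k`. -/
noncomputable def tree (k : Mode d) (ω : Noise d) : Tree d where
  pos α := if S.Realised k ω α then some (hatPos k ω α) else none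
  birth α := S.birthTime k ω α
  death α := S.deathTime k ω α

/-- The expectation `E_k[F]` in `[0, ∞]` of a non-negative function `F` of the tree rooted
at `k`. -/
noncomputable def expect (k : Mode d) (F : Tree d → ℝ≥0∞) : ℝ≥0∞ :=
  ∫⁻ ω, F (S.tree k ω) ∂S.noiseLaw

/-- The evaluation operator `R_t` for the initial condition `χ₀` and the forcing `γ`. -/
noncomputable def R (χ₀ : Mode d → State r) (γ : Mode d → ℝ → State r) (t : ℝ)
    (𝒯 : Tree d) : State r :=
  eval S.Cf S.Cb (fun k l m x y => S.B k l m x y) χ₀ γ t 𝒯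

/-- The positive evaluation operator `R̃_t`: the data are replaced by their norms, the bilinear
operators by the product of real numbers. -/
noncomputable def Rpos (χ₀ : Mode d → State r) (γ : Mode d → ℝ → State r) (t : ℝ)
    (𝒯 : Tree d) : ℝ :=
  eval S.Cf S.Cb (fun _ _ _ x y => x * y) (fun k => ‖χ₀ k‖) (fun k s => ‖γ k s‖) t 𝒯

/-- `E_k[R̃_t]`. -/
noncomputable def expRpos (χ₀ : Mode d → State r) (γ : Mode d → ℝ → State r) (k : Mode d)
    (t : ℝ) : ℝ≥0∞ :=
  S.expect k fun 𝒯 => ENNReal.ofReal (S.Rpos χ₀ γ t 𝒯)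

/-- `E_k|R_t|`. -/
noncomputable def expNormR (χ₀ : Mode d → State r) (γ : Mode d → ℝ → State r) (k : Mode d)
    (t : ℝ) : ℝ≥0∞ :=
  S.expect k fun 𝒯 => ENNReal.ofReal ‖S.R χ₀ γ t 𝒯‖

/-- Non-negative (possibly infinite) mild solutions on `[0, T]` of the comparison system
`u_k' = lam_k [-u_k + Cf p_k u_k + Cb ∑_{l,m} q_{k,l,m} u_l u_m + dd_k |γ_k|]`,
`u_k(0) = |χ₀_k|`. As every term is non-negative, integral and series are taken in `[0, ∞]`; for
a finite `u` the equation says in particular that they converge. -/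
def IsMildComparison (χ₀ : Mode d → State r) (γ : Mode d → ℝ → State r) (T : ℝ)
    (u : Mode d → ℝ → ℝ≥0∞) : Prop :=
  ∀ k, Measurable (fun t : Icc 0 T => u k t) ∧ ∀ t ∈ Icc 0 T,
    u k t = ENNReal.ofReal (Real.exp (-S.lam k * t)) * ENNReal.ofReal ‖χ₀ k‖ +
      ∫⁻ s in Icc 0 t, ENNReal.ofReal (S.lam k * Real.exp (-S.lam k * (t - s))) *
        (ENNReal.ofReal (S.Cf * S.p k) * u k s +
          ENNReal.ofReal S.Cb * (∑' lm : Mode d × Mode d,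
            ENNReal.ofReal (S.q k lm.1 lm.2) * (u lm.1 s * u lm.2 s)) +
          ENNReal.ofReal (S.dd k) * ENNReal.ofReal ‖γ k s‖)

/-! The recursions over the generations, and the recursive formula for the evaluation. -/

theorem hatPos_append (k : Mode d) (ω : Noise d) (α : Label) (i : Fin 3) :
    hatPos k ω (α ++ [i]) = childPos (hatPos k ω α) (ω α) i := by
  induction α generalizing k ω with
  | nil => rfl
  | cons j α ih => simpa [hatPos] using ih _ _

theorem realised_append (k : Mode d) (ω : Noise d) (α : Label) (i : Fin 3) :
    S.Realised k ω (α ++ [i]) ↔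
      S.Realised k ω α ∧ S.childAlive (hatPos k ω α) (ω α) i := by
  induction α generalizing k ω with
  | nil => simp [Realised, hatPos]
  | cons j α ih => simp [Realised, hatPos, ih, and_assoc]

theorem birthTime_append (k : Mode d) (ω : Noise d) (α : Label) (i : Fin 3) :
    S.birthTime k ω (α ++ [i]) = S.deathTime k ω α := by
  induction α generalizing k ω with
  | nil => simp [birthTime, deathTime, hatPos]
  | cons j α ih =>
    have := ih (childPos k (ω []) j) (fun β => ω (j :: β))
    simp only [List.cons_append, birthTime, this]
    simp [deathTime, birthTime, hatPos, add_assoc]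

theorem shift_tree (k : Mode d) (ω : Noise d) (i : Fin 3) (h : S.childAlive k (ω []) i) :
    (S.tree k ω).shift i = S.tree (childPos k (ω []) i) (fun β => ω (i :: β)) := by
  ext α : 2
  · classical exact if_congr (by simp [Realised, h]) rfl rfl
  · simp [Tree.shift, tree, deathTime, birthTime, hatPos]
  · simp [Tree.shift, tree, deathTime, birthTime, hatPos]
    ring

theorem tree_pos_nil (k : Mode d) (ω : Noise d) : (S.tree k ω).pos [] = some k := by
  simp [tree, Realised, hatPos]

open Classical in
theorem tree_pos_singleton (k : Mode d) (ω : Noise d) (i : Fin 3) :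
    (S.tree k ω).pos [i] =
      if S.childAlive k (ω []) i then some (childPos k (ω []) i) else none := by
  simp [tree, Realised, hatPos]

theorem born_shift (k : Mode d) (ω : Noise d) (i : Fin 3) (t : ℝ)
    (ht : 0 ≤ t) (hfin : ((S.tree k ω).born t).Finite) :
    (((S.tree k ω).shift i).born (t - (S.tree k ω).death [])).Finite ∧
      (((S.tree k ω).shift i).born (t - (S.tree k ω).death [])).ncard <
        ((S.tree k ω).born t).ncard := by
  have hsub : List.cons i '' ((S.tree k ω).shift i).born (t - (S.tree k ω).death []) ⊂
      (S.tree k ω).born t := by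
    refine ⟨?_, fun h => ?_⟩
    · rintro _ ⟨α, ⟨h1, h2⟩, rfl⟩
      exact ⟨h1, by simpa [Tree.shift] using h2⟩
    · have : ([] : Label) ∈ (S.tree k ω).born t :=
        ⟨by simp [tree_pos_nil], by simpa [tree, birthTime] using ht⟩
      obtain ⟨α, -, h⟩ := h this
      simp at h
  have hinj : Function.Injective (List.cons i) := List.cons_injective
  have hf := (hfin.subset hsub.1).of_finite_image hinj.injOn
  refine ⟨hf, ?_⟩
  rw [← ncard_image_of_injective _ hinj]
  exact ncard_lt_ncard hsub hfin

section Evaluation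

variable {V : Type*} [AddCommGroup V] [Module ℝ V] (Cf Cb : ℝ)
  (B : Mode d → Mode d → Mode d → V → V → V) (init : Mode d → V) (force : Mode d → ℝ → V)

theorem evalApprox_tree (n : ℕ) (k : Mode d) (ω : Noise d) (t : ℝ) :
    evalApprox Cf Cb B init force (n + 1) t (S.tree k ω) =
      if t ≤ (S.tree k ω).death [] then init k
      else
        match (S.tree k ω).pos [0], (S.tree k ω).pos [1], (S.tree k ω).pos [2] with
        | none, none, none => force k (t - (S.tree k ω).death [])
        | some _, none, none => Cf • evalApprox Cf Cb B init force n
            (t - (S.tree k ω).death []) ((S.tree k ω).shift 0)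
        | none, some l, some m => Cb • B k l m
            (evalApprox Cf Cb B init force n
              (t - (S.tree k ω).death []) ((S.tree k ω).shift 1))
            (evalApprox Cf Cb B init force n
              (t - (S.tree k ω).death []) ((S.tree k ω).shift 2))
        | _, _, _ => 0 := by
  rw [evalApprox]
  simp only [tree_pos_nil]

/-- Following the tree for more generations than there are particles changes nothing. -/
theorem evalApprox_succ (n : ℕ) : ∀ (k : Mode d) (ω : Noise d) (t : ℝ), 0 ≤ t →
    ((S.tree k ω).born t).Finite → ((S.tree k ω).born t).ncard ≤ n →
    evalApprox Cf Cb B init force (n + 1) t (S.tree k ω) =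
      evalApprox Cf Cb B init force n t (S.tree k ω) := by
  induction n with
  | zero =>
    intro k ω t ht hf hn
    have := (S.born_shift k ω 0 t ht hf).2
    omega
  | succ n ih =>
    intro k ω t ht hf hn
    by_cases h : t ≤ (S.tree k ω).death []
    · simp [evalApprox, tree_pos_nil, h]
    have key : ∀ i, S.childAlive k (ω []) i →
        evalApprox Cf Cb B init force (n + 1) (t - (S.tree k ω).death [])
            ((S.tree k ω).shift i) =
          evalApprox Cf Cb B init force n (t - (S.tree k ω).death [])
            ((S.tree k ω).shift i) := by
      intro i hi
      have hb := S.born_shift k ω i t ht hf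
      rw [S.shift_tree k ω i hi] at hb ⊢
      exact ih _ _ _ (by linarith) hb.1 (by omega)
    rw [S.evalApprox_tree Cf Cb B init force (n + 1), S.evalApprox_tree Cf Cb B init force n]
    simp only [tree_pos_singleton, h, if_false]
    by_cases h0 : S.childAlive k (ω []) 0 <;> by_cases h1 : S.childAlive k (ω []) 1 <;>
      by_cases h2 : S.childAlive k (ω []) 2 <;> simp [h0, h1, h2, key]

theorem evalApprox_eq_eval (n : ℕ) (k : Mode d) (ω : Noise d) (t : ℝ) (ht : 0 ≤ t)
    (hf : ((S.tree k ω).born t).Finite) (hn : ((S.tree k ω).born t).ncard ≤ n) :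
    evalApprox Cf Cb B init force n t (S.tree k ω) =
      eval Cf Cb B init force t (S.tree k ω) := by
  rw [eval, if_pos hf]
  induction n, hn using Nat.le_induction with
  | base => rfl
  | succ m hm ih => rw [← ih, S.evalApprox_succ Cf Cb B init force m k ω t ht hf hm]

/-- The implicit formula for the evaluation: on a branching tree with finitely many particles born
in `[0, t]`, the evaluation is the initial condition, the forcing, or is computed from the
evaluations of the shifted subtrees, according to what happens to the root. -/
theorem eval_tree (k : Mode d) (ω : Noise d) (t : ℝ) (ht : 0 ≤ t)
    (hf : ((S.tree k ω).born t).Finite) :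
    eval Cf Cb B init force t (S.tree k ω) =
      if t ≤ (S.tree k ω).death [] then init k
      else
        match (S.tree k ω).pos [0], (S.tree k ω).pos [1], (S.tree k ω).pos [2] with
        | none, none, none => force k (t - (S.tree k ω).death [])
        | some _, none, none =>
          Cf • eval Cf Cb B init force (t - (S.tree k ω).death []) ((S.tree k ω).shift 0)
        | none, some l, some m =>
          Cb • B k l m
            (eval Cf Cb B init force (t - (S.tree k ω).death []) ((S.tree k ω).shift 1))
            (eval Cf Cb B init force (t - (S.tree k ω).death []) ((S.tree k ω).shift 2))
        | _, _, _ => 0 := by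
  by_cases h : t ≤ (S.tree k ω).death []
  · rw [← S.evalApprox_eq_eval Cf Cb B init force _ k ω t ht hf (Nat.le_succ _)]
    simp [evalApprox, tree_pos_nil, h]
  have key : ∀ i, S.childAlive k (ω []) i →
      evalApprox Cf Cb B init force ((S.tree k ω).born t).ncard
          (t - (S.tree k ω).death []) ((S.tree k ω).shift i) =
        eval Cf Cb B init force (t - (S.tree k ω).death []) ((S.tree k ω).shift i) := by
    intro i hi
    have hb := S.born_shift k ω i t ht hf
    rw [S.shift_tree k ω i hi] at hb ⊢
    exact S.evalApprox_eq_eval Cf Cb B init force _ _ _ _ (by linarith) hb.1 hb.2.le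
  rw [← S.evalApprox_eq_eval Cf Cb B init force _ k ω t ht hf (Nat.le_succ _), S.evalApprox_tree Cf Cb B init force]
  simp only [tree_pos_singleton, h, if_false]
  by_cases h0 : S.childAlive k (ω []) 0 <;> by_cases h1 : S.childAlive k (ω []) 1 <;>
    by_cases h2 : S.childAlive k (ω []) 2 <;> simp [h0, h1, h2, key]

end Evaluation

end System

end BranchTree

/-! Condition on the root. Its mark is independent of the three subtrees below its potential
children, and these are independent copies of the whole noise (`map_node`). Integrating one step of
the positive evaluation over the exponential lifetime, the uniform choice and the offspring
positions yields the right-hand side `mildMap` of the mild equation. In the branching case the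
expectation of the product factors by independence (`lintegral_step`).

Applied to the full evaluation, for which one step reproduces the evaluation almost surely
(`posEval_eq_step`), this shows that the expectation solves the mild equation, as an identity in [0,
∞]. Trees with infinitely many births cause no defect: there the evaluation is 0, and one step also
gives 0.

Applied to the evaluation truncated after `n` generations, it shows that the truncated expectations
are the Picard iterates of `mildMap` started from 0. As `mildMap` is monotone, they stay below every
non-negative solution, and Fatou's lemma passes the bound to the full evaluation (`expRpos_le`).

Continuity holds because the mild formula is an exponential times a constant plus the primitive of
an integrable function. The comparison of `R` with `Rpos` is pathwise, by induction over the
generations. -/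

namespace BranchTree

/-! ### Decomposition of the noise at the root -/

/-- The noise with mark `x` at the root and noises `ω₀, ω₁, ω₂` at the descendants of the potential
children of the root. -/
def Noise.node {d : ℕ} (z : Mark d × Noise d × Noise d × Noise d) : Noise d
  | [] => z.1
  | i :: α => if i = 0 then z.2.1 α else if i = 1 then z.2.2.1 α else z.2.2.2 α

theorem Noise.measurable_node {d : ℕ} : Measurable (Noise.node (d := d)) := by
  refine measurable_pi_lambda _ fun α => ?_
  match α with
  | [] => exact measurable_fst
  | i :: α =>
    simp only [Noise.node]
    split_ifs <;> fun_prop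

namespace System

variable {d r : ℕ} (S : System d r)

instance : IsProbabilityMeasure S.noiseLaw := by
  unfold noiseLaw
  infer_instance

/-- The noise is made of the mark of the root and of three independent copies of itself. -/
theorem map_node :
    (S.markLaw.prod (S.noiseLaw.prod (S.noiseLaw.prod S.noiseLaw))).map Noise.node =
      S.noiseLaw := by
  classical
  -- The product law is determined by finite boxes. The index set `s` is enlarged to `s'`, the root
  -- together with `i :: α` for every letter `i` and every `α` in one common finite set `a`; the
  -- added coordinates are unconstrained. The preimage of such a box is a product of four boxes.
  refine Measure.eq_infinitePi _ fun s t ht => ?_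
  set t' : Label → Set (Mark d) := fun α => if α ∈ s then t α else univ with ht'
  have mt' : ∀ α, MeasurableSet (t' α) := fun α => by
    simp only [ht']; split_ifs
    exacts [ht α, .univ]
  let a : Finset Label := s.image List.tail
  let e : Fin 3 × Label ↪ Label := ⟨fun p => p.1 :: p.2, fun p q h => by
    simpa [Prod.ext_iff] using h⟩
  have hnil : ([] : Label) ∉ (Finset.univ ×ˢ a).map e := by simp [e]
  let s' : Finset Label := Finset.cons [] ((Finset.univ ×ˢ a).map e) hnil
  have hs : s ⊆ s' := by
    intro α hα
    match α with
    | [] => simp [s']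
    | i :: α =>
      simp only [s', e, Finset.mem_cons, Finset.mem_map, Finset.mem_product, Finset.mem_univ,
        true_and, Prod.exists]
      exact .inr ⟨i, α, Finset.mem_image.2 ⟨_, hα, rfl⟩, rfl⟩
  have hpi : (s : Set Label).pi t = (s' : Set Label).pi t' := by
    ext ω
    simp only [Set.mem_pi, Finset.mem_coe, ht']
    refine ⟨fun h α _ => ?_, fun h α hα => by simpa [hα] using h α (hs hα)⟩
    by_cases hα : α ∈ s <;> simp [hα, h]
  have hprod : ∏ α ∈ s, S.markLaw (t α) = ∏ α ∈ s', S.markLaw (t' α) := by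
    rw [← Finset.prod_subset hs (f := fun α => S.markLaw (t' α)) fun α _ hα => by simp [ht', hα]]
    exact Finset.prod_congr rfl fun α hα => by simp [ht', hα]
  have hpre : Noise.node ⁻¹' ((s' : Set Label).pi t') =
      t' [] ×ˢ ((a : Set Label).pi (fun α => t' (0 :: α)) ×ˢ
        ((a : Set Label).pi (fun α => t' (1 :: α)) ×ˢ
          (a : Set Label).pi (fun α => t' (2 :: α)))) := by
    ext z
    simp only [mem_preimage, Set.mem_pi, Finset.mem_coe, mem_prod, s', e, Finset.mem_cons,
      Finset.mem_map, Finset.mem_product, Finset.mem_univ, true_and,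
      Prod.exists]
    constructor
    · intro h
      exact ⟨h [] (.inl rfl), fun α hα => h _ (.inr ⟨0, α, hα, rfl⟩),
        fun α hα => h _ (.inr ⟨1, α, hα, rfl⟩), fun α hα => h _ (.inr ⟨2, α, hα, rfl⟩)⟩
    · rintro ⟨h, h0, h1, h2⟩ _ (rfl | ⟨i, α, hα, rfl⟩)
      · exact h
      · fin_cases i
        exacts [h0 α hα, h1 α hα, h2 α hα]
  rw [hpi, hprod, Measure.map_apply Noise.measurable_node
    (.pi (Finset.countable_toSet _) fun _ _ => mt' _), hpre]
  simp only [Measure.prod_prod, noiseLaw, s', Finset.prod_cons, Finset.prod_map,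
    Finset.prod_product, Fin.prod_univ_three]
  rw [Measure.infinitePi_pi _ fun _ _ => mt' _, Measure.infinitePi_pi _ fun _ _ => mt' _,
    Measure.infinitePi_pi _ fun _ _ => mt' _]
  simp only [mul_assoc]
  rfl

theorem lintegral_node {f : Noise d → ℝ≥0∞} (hf : Measurable f) :
    ∫⁻ ω, f ω ∂S.noiseLaw = ∫⁻ x, ∫⁻ ω₀, ∫⁻ ω₁, ∫⁻ ω₂, f (Noise.node (x, ω₀, ω₁, ω₂))
      ∂S.noiseLaw ∂S.noiseLaw ∂S.noiseLaw ∂S.markLaw := by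
  have hm : Measurable fun z => f (Noise.node z) := hf.comp Noise.measurable_node
  conv_lhs => rw [← S.map_node, lintegral_map hf Noise.measurable_node]
  rw [lintegral_prod _ hm.aemeasurable]
  refine lintegral_congr fun x => ?_
  have hx : Measurable fun y => f (Noise.node (x, y)) := hm.comp measurable_prodMk_left
  rw [lintegral_prod _ hx.aemeasurable]
  refine lintegral_congr fun y => ?_
  have hy : Measurable fun z => f (Noise.node (x, y, z)) := hx.comp measurable_prodMk_left
  rw [lintegral_prod _ hy.aemeasurable]

/-! ### Integrals over the mark of the root -/

theorem qTot_nonneg (k : Mode d) : 0 ≤ S.qTot k := tsum_nonneg fun _ => (S.q_mem _ _ _).1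

theorem tsum_ofReal_q (k : Mode d) :
    ∑' lm : Mode d × Mode d, ENNReal.ofReal (S.q k lm.1 lm.2) = ENNReal.ofReal (S.qTot k) :=
  (ENNReal.ofReal_tsum_of_nonneg (fun _ => (S.q_mem _ _ _).1) (S.q_summable k)).symm

/-- The factor `q_k` cancels the normalisation of the offspring law. If `q_k = 0`, every `q_{k,l,m}`
vanishes and the arbitrary law plays no role. -/
theorem qTot_mul_offspring (k l m : Mode d) :
    ENNReal.ofReal (S.qTot k) * S.offspring k (l, m) = ENNReal.ofReal (S.q k l m) := by
  by_cases h : ENNReal.ofReal (S.qTot k) = 0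
  · have := S.tsum_ofReal_q k
    rw [h, ENNReal.tsum_eq_zero] at this
    rw [h, zero_mul, this (l, m)]
  · have h1 := S.tsum_ofReal_q k
    rw [offspring, dif_pos (by rw [h1]; exact ⟨h, ENNReal.ofReal_ne_top⟩), PMF.normalize_apply, h1,
      mul_comm, mul_assoc, ENNReal.inv_mul_cancel h ENNReal.ofReal_ne_top, mul_one]

theorem lintegral_offspring (k : Mode d) (f : Mode d × Mode d → ℝ≥0∞) :
    ENNReal.ofReal (S.qTot k) *
        ∫⁻ y, f (y k) ∂(Measure.infinitePi fun k => (S.offspring k).toMeasure) =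
      ∑' lm : Mode d × Mode d, ENNReal.ofReal (S.q k lm.1 lm.2) * f lm := by
  have h := measurePreserving_eval_infinitePi (fun k => (S.offspring k).toMeasure) k
  have hf : Measurable f := measurable_of_countable f
  rw [show (fun y : Mode d → Mode d × Mode d => f (y k)) = fun y => f (Function.eval k y) from rfl,
    h.lintegral_comp hf, lintegral_countable', ← ENNReal.tsum_mul_left]
  refine tsum_congr fun lm => ?_
  rw [PMF.toMeasure_apply_singleton _ _ (measurableSet_singleton lm), mul_comm (f lm), ← mul_assoc,
    qTot_mul_offspring]

open Classical in
-- Since `p + q ≤ 1`, the flip and branch intervals meet at most in the point `p`, a null set. So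
-- the value 0 given to a simultaneous flip and branch does not contribute.
theorem lintegral_uniform_cases {p q : ℝ} (hp : 0 ≤ p) (hq : 0 ≤ q) (hpq : p + q ≤ 1)
    (a b c : ℝ≥0∞) :
    ∫⁻ u in Icc (0 : ℝ) 1, (if u ∈ Icc 0 p then if u ∈ Icc (1 - q) 1 then 0 else a
        else if u ∈ Icc (1 - q) 1 then b else c) =
      ENNReal.ofReal p * a + ENNReal.ofReal q * b + ENNReal.ofReal (1 - p - q) * c := by
  have h : ∀ᵐ u ∂(volume.restrict (Icc (0 : ℝ) 1)),
      (if u ∈ Icc 0 p then if u ∈ Icc (1 - q) 1 then 0 else a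
        else if u ∈ Icc (1 - q) 1 then b else c) =
      (Icc 0 p).indicator (fun _ => a) u + (Icc (1 - q) 1).indicator (fun _ => b) u +
        (Ioo p (1 - q)).indicator (fun _ => c) u := by
    filter_upwards [ae_restrict_mem measurableSet_Icc,
      ae_restrict_of_ae (Measure.ae_ne volume p)] with u hu hne
    have h1 : u ∈ Icc 0 p ↔ u < p :=
      ⟨fun h => lt_of_le_of_ne h.2 hne, fun h => ⟨hu.1, h.le⟩⟩
    have h2 : u ∈ Icc (1 - q) 1 ↔ 1 - q ≤ u := ⟨fun h => h.1, fun h => ⟨h, hu.2⟩⟩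
    have h3 : u ∈ Ioo p (1 - q) ↔ ¬ u < p ∧ ¬ 1 - q ≤ u :=
      ⟨fun h => ⟨not_lt.2 h.1.le, not_le.2 h.2⟩,
        fun h => ⟨lt_of_le_of_ne (not_lt.1 h.1) hne.symm, not_le.1 h.2⟩⟩
    simp only [indicator_apply, h1, h2, h3]
    by_cases hup : u < p
    · have : ¬ 1 - q ≤ u := by linarith
      simp [hup, this]
    · by_cases huq : 1 - q ≤ u <;> simp [hup, huq]
  rw [lintegral_congr_ae h, lintegral_add_right _ (measurable_const.indicator measurableSet_Ioo),
    lintegral_add_right _ (measurable_const.indicator measurableSet_Icc),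
    lintegral_indicator_const measurableSet_Icc, lintegral_indicator_const measurableSet_Icc,
    lintegral_indicator_const measurableSet_Ioo, Measure.restrict_apply measurableSet_Icc,
    Measure.restrict_apply measurableSet_Icc, Measure.restrict_apply measurableSet_Ioo,
    inter_eq_left.2 (Icc_subset_Icc le_rfl (by linarith)),
    inter_eq_left.2 (Icc_subset_Icc (by linarith) le_rfl),
    inter_eq_left.2 ((Ioo_subset_Icc_self).trans (Icc_subset_Icc hp (by linarith)))]
  simp only [Real.volume_Icc, Real.volume_Ioo]
  rw [mul_comm a, mul_comm b, mul_comm c]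
  rw [sub_zero, sub_sub_cancel, sub_right_comm]

/-- The root survives up to time `t` with probability `exp (-lam * t)`. Otherwise the substitution
`e = lam * (t - s)` replaces the lifetime by the time `s` that remains after the death, and the
exponential density becomes the kernel of the mild equation. -/
theorem lintegral_expMeasure_cases {lam t : ℝ} (hlam : 0 < lam) (ht : 0 ≤ t) (a : ℝ≥0∞)
    {g : ℝ → ℝ≥0∞} (hg : Measurable g) :
    ∫⁻ e, (if t ≤ lam⁻¹ * e then a else g (t - lam⁻¹ * e)) ∂(expMeasure 1) =
      ENNReal.ofReal (Real.exp (-lam * t)) * a +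
        ∫⁻ s in Icc 0 t, ENNReal.ofReal (lam * Real.exp (-lam * (t - s))) * g s := by
  have : IsProbabilityMeasure (expMeasure 1) := isProbabilityMeasure_expMeasure one_pos
  have hm : Measurable (fun e : ℝ => if t ≤ lam⁻¹ * e then a else g (t - lam⁻¹ * e)) :=
    Measurable.ite (measurableSet_le measurable_const (by fun_prop)) measurable_const (by fun_prop)
  have hpdf : Measurable (exponentialPDF 1) := by unfold exponentialPDF; fun_prop
  have hle : ∀ e, t ≤ lam⁻¹ * e ↔ lam * t ≤ e := fun e => by
    rw [inv_mul_eq_div, le_div_iff₀ hlam, mul_comm]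
  have hE : expMeasure 1 = volume.withDensity (exponentialPDF 1) := rfl
  rw [← lintegral_add_compl _ (measurableSet_Ici (a := lam * t))]
  congr 1
  · rw [setLIntegral_congr_fun (g := fun _ => a) measurableSet_Ici fun e he => if_pos ((hle e).2 he),
      setLIntegral_const, mul_comm]
    congr 1
    have h1 : expMeasure 1 (Iic (lam * t)) = ENNReal.ofReal (1 - Real.exp (-(1 * (lam * t)))) := by
      rw [hE, withDensity_apply _ measurableSet_Iic,
        lintegral_exponentialPDF_eq_antiDeriv one_pos, if_pos (by positivity)]
    have h2 : expMeasure 1 (Iio (lam * t)) = ENNReal.ofReal (1 - Real.exp (-(1 * (lam * t)))) := by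
      have : NullMeasurableSet (Iio (lam * t)) (expMeasure 1) := measurableSet_Iio.nullMeasurableSet
      have : expMeasure 1 ≪ volume := withDensity_absolutelyContinuous _ _
      rw [← h1]
      exact measure_congr (this.ae_eq Iio_ae_eq_Iic)
    rw [← compl_Iio, prob_compl_eq_one_sub measurableSet_Iio, h2, ← ENNReal.ofReal_one,
      ← ENNReal.ofReal_sub _ (by simp; positivity)]
    congr 1
    ring_nf
  · rw [compl_Ici, hE, setLIntegral_withDensity_eq_setLIntegral_mul _ hpdf hm measurableSet_Iio]
    have himg : (fun s => lam * (t - s)) '' Ioc 0 t = Ico 0 (lam * t) := by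
      ext e
      constructor
      · rintro ⟨s, ⟨h1, h2⟩, rfl⟩
        exact ⟨mul_nonneg hlam.le (by linarith), by nlinarith⟩
      · rintro ⟨h1, h2⟩
        refine ⟨t - lam⁻¹ * e, ⟨?_, ?_⟩, ?_⟩
        · have := (hle e).not.2 (not_le.2 h2)
          linarith
        · have : 0 ≤ lam⁻¹ * e := by positivity
          linarith
        · field_simp; ring
    -- The density vanishes on negative lifetimes, which leaves exactly the image of `Ioc 0 t` under
    -- the substitution.
    have hzero : ∫⁻ e in Iio (lam * t), (exponentialPDF 1 *
        fun e => if t ≤ lam⁻¹ * e then a else g (t - lam⁻¹ * e)) e =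
        ∫⁻ e in Ico 0 (lam * t), exponentialPDF 1 e * g (t - lam⁻¹ * e) := by
      rw [← lintegral_indicator measurableSet_Iio, ← lintegral_indicator measurableSet_Ico]
      refine lintegral_congr fun e => ?_
      by_cases he : 0 ≤ e
      · by_cases h2 : e < lam * t
        · have : ¬ t ≤ lam⁻¹ * e := by rw [hle]; linarith
          simp [he, h2, this]
        · simp [h2]
      · simp [indicator_apply, exponentialPDF_of_neg (not_le.1 he)]
    rw [hzero, ← himg, lintegral_image_eq_lintegral_abs_deriv_mul measurableSet_Ioc
      (f' := fun _ => -lam)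
      (fun s _ => by
        simpa using (((hasDerivAt_id s).const_sub t).const_mul lam).hasDerivWithinAt)
      (fun x _ y _ h => by simpa [hlam.ne'] using h),
      setLIntegral_congr Ioc_ae_eq_Icc]
    refine setLIntegral_congr_fun measurableSet_Icc fun s hs => ?_
    have : 0 ≤ lam * (t - s) := mul_nonneg hlam.le (by linarith [hs.2])
    have h3 : t - lam⁻¹ * (lam * (t - s)) = s := by field_simp; ring
    change _ * (exponentialPDF 1 (lam * (t - s)) * g (t - lam⁻¹ * (lam * (t - s)))) = _
    rw [h3, exponentialPDF_of_nonneg this, ← mul_assoc, ← ENNReal.ofReal_mul (by positivity),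
      abs_neg, abs_of_pos hlam]
    ring_nf

end System

end BranchTree

/-! ### One step of the evaluation and the mild equation -/

namespace BranchTree

namespace System

variable {d r : ℕ} (S : System d r) (χ₀ : Mode d → State r) (γ : Mode d → ℝ → State r)

open Classical in
/-- One step of the positive evaluation at time `t` for a root at `k` with mark `x`, when the
evaluations `F` of the subtrees depend on parameters `w₀, w₁, w₂`. -/
noncomputable def step {Ω : Type*} (F : Mode d → ℝ → Ω → ℝ≥0∞) (k : Mode d) (t : ℝ) (x : Mark d)
    (w₀ w₁ w₂ : Ω) : ℝ≥0∞ :=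
  if t ≤ (S.lam k)⁻¹ * x.1 then ENNReal.ofReal ‖χ₀ k‖
  else if x.2.1 ∈ Icc 0 (S.p k) then
    if x.2.1 ∈ Icc (1 - S.qTot k) 1 then 0
    else ENNReal.ofReal S.Cf * F k (t - (S.lam k)⁻¹ * x.1) w₀
  else if x.2.1 ∈ Icc (1 - S.qTot k) 1 then
    ENNReal.ofReal S.Cb * (F (x.2.2 k).1 (t - (S.lam k)⁻¹ * x.1) w₁ *
      F (x.2.2 k).2 (t - (S.lam k)⁻¹ * x.1) w₂)
  else ENNReal.ofReal ‖γ k (t - (S.lam k)⁻¹ * x.1)‖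

/-- The right-hand side of the mild formulation of the comparison system. -/
noncomputable def mildMap (u : Mode d → ℝ → ℝ≥0∞) (k : Mode d) (t : ℝ) : ℝ≥0∞ :=
  ENNReal.ofReal (Real.exp (-S.lam k * t)) * ENNReal.ofReal ‖χ₀ k‖ +
    ∫⁻ s in Icc 0 t, ENNReal.ofReal (S.lam k * Real.exp (-S.lam k * (t - s))) *
      (ENNReal.ofReal (S.Cf * S.p k) * u k s +
        ENNReal.ofReal S.Cb * (∑' lm : Mode d × Mode d,
          ENNReal.ofReal (S.q k lm.1 lm.2) * (u lm.1 s * u lm.2 s)) +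
        ENNReal.ofReal (S.dd k) * ENNReal.ofReal ‖γ k s‖)

theorem mildMap_mono {u v : Mode d → ℝ → ℝ≥0∞} {T t : ℝ} (ht : t ∈ Icc 0 T)
    (huv : ∀ k, ∀ s ∈ Icc 0 T, u k s ≤ v k s) (k : Mode d) :
    S.mildMap χ₀ γ u k t ≤ S.mildMap χ₀ γ v k t := by
  unfold mildMap
  gcongr 1
  refine setLIntegral_mono' measurableSet_Icc fun s hs => ?_
  have hs' : s ∈ Icc 0 T := ⟨hs.1, hs.2.trans ht.2⟩
  gcongr <;> exact huv _ _ hs'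

variable {χ₀ γ}

/-- The positions of the children are random, so measurability is needed jointly in the mode; modes
being countable, it can be checked one mode at a time. -/
theorem measurable_mode_prod {α β : Type*} [MeasurableSpace α] [MeasurableSpace β]
    {f : Mode d × α → β} (hf : ∀ k, Measurable fun a => f (k, a)) : Measurable f :=
  measurable_from_prod_countable_right hf

theorem measurable_step (hγ : ∀ k, Measurable (γ k)) {Ω : Type*} [MeasurableSpace Ω]
    {F : Mode d → ℝ → Ω → ℝ≥0∞} (hF : ∀ k, Measurable fun z : ℝ × Ω => F k z.1 z.2)
    (k : Mode d) :
    Measurable fun z : ℝ × Mark d × Ω × Ω × Ω =>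
      S.step χ₀ γ F k z.1 z.2.1 z.2.2.1 z.2.2.2.1 z.2.2.2.2 := by
  have hs : Measurable fun z : ℝ × Mark d × Ω × Ω × Ω => z.1 - (S.lam k)⁻¹ * z.2.1.1 := by fun_prop
  have hu : Measurable fun z : ℝ × Mark d × Ω × Ω × Ω => z.2.1.2.1 := by fun_prop
  have hF' : Measurable fun z : Mode d × ℝ × Ω => F z.1 z.2.1 z.2.2 := measurable_mode_prod hF
  have hγk := hγ k
  have hy : Measurable fun z : ℝ × Mark d × Ω × Ω × Ω => z.2.1.2.2 k := by fun_prop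
  refine Measurable.ite (measurableSet_le (by fun_prop) (by fun_prop)) measurable_const ?_
  refine Measurable.ite (hu measurableSet_Icc) ?_ ?_
  · refine Measurable.ite (hu measurableSet_Icc) measurable_const ?_
    exact ((hF k).comp (hs.prodMk measurable_snd.snd.fst)).const_mul _
  · refine Measurable.ite (hu measurableSet_Icc) ?_ (by fun_prop)
    exact ((hF'.comp (hy.fst.prodMk (hs.prodMk measurable_snd.snd.snd.fst))).mul
      (hF'.comp (hy.snd.prodMk (hs.prodMk measurable_snd.snd.snd.snd)))).const_mul _

/-- The integral of one step of the evaluation over the mark of the root. -/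
theorem lintegral_step_mark (hγ : ∀ k, Measurable (γ k)) {f : Mode d → ℝ → ℝ≥0∞}
    (hf : ∀ k, Measurable (f k)) (k : Mode d) {t : ℝ} (ht : 0 ≤ t) :
    ∫⁻ x, S.step χ₀ γ (fun k s (_ : Unit) => f k s) k t x () () () ∂S.markLaw =
      S.mildMap χ₀ γ f k t := by
  have : IsProbabilityMeasure (expMeasure 1) := isProbabilityMeasure_expMeasure one_pos
  have hF : ∀ k, Measurable fun z : ℝ × Unit => f k z.1 := fun k => (hf k).comp measurable_fst
  have hm : Measurable fun x : Mark d => S.step χ₀ γ (fun k s (_ : Unit) => f k s) k t x () () () :=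
    (S.measurable_step (χ₀ := χ₀) hγ hF k).comp (g := fun z : ℝ × Mark d × Unit × Unit × Unit =>
      S.step χ₀ γ (fun k s (_ : Unit) => f k s) k z.1 z.2.1 z.2.2.1 z.2.2.2.1 z.2.2.2.2)
      (f := fun x => (t, x, (), (), ())) (by fun_prop)
  have hf' : Measurable fun z : Mode d × ℝ => f z.1 z.2 := measurable_mode_prod hf
  set g : ℝ → ℝ≥0∞ := fun s => ENNReal.ofReal (S.Cf * S.p k) * f k s +
        ENNReal.ofReal S.Cb * (∑' lm : Mode d × Mode d,
          ENNReal.ofReal (S.q k lm.1 lm.2) * (f lm.1 s * f lm.2 s)) +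
        ENNReal.ofReal (S.dd k) * ENNReal.ofReal ‖γ k s‖ with hg
  have hγk := hγ k
  have hgm : Measurable g := by
    refine (((hf k).const_mul _).add (Measurable.const_mul ?_ _)).add (by fun_prop)
    exact Measurable.tsum fun lm => ((hf _).mul (hf _)).const_mul _
  rw [markLaw, lintegral_prod _ hm.aemeasurable, mildMap,
    ← lintegral_expMeasure_cases (S.lam_pos k) ht _ hgm]
  refine lintegral_congr fun e => ?_
  have hme : Measurable fun y : ℝ × (Mode d → Mode d × Mode d) =>
      S.step χ₀ γ (fun k s (_ : Unit) => f k s) k t (e, y) () () () := hm.comp measurable_prodMk_left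
  rw [lintegral_prod _ hme.aemeasurable]
  by_cases hte : t ≤ (S.lam k)⁻¹ * e
  · simp [step, hte]
  rw [if_neg hte]
  set s := t - (S.lam k)⁻¹ * e
  have hprob : 1 - S.p k - S.qTot k = S.dd k := by
    have := S.prob_sum k
    rw [qTot]; linarith
  have hp := (S.p_mem k).1
  have hd := (S.dd_mem k).1
  -- The probability left over after flip and branch is `dd k`, by `prob_sum`.
  have key := lintegral_uniform_cases hp (S.qTot_nonneg k) (by linarith)
    (ENNReal.ofReal S.Cf * f k s)
    (∫⁻ y, ENNReal.ofReal S.Cb * (f (y k).1 s * f (y k).2 s)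
      ∂(Measure.infinitePi fun k => (S.offspring k).toMeasure)) (ENNReal.ofReal ‖γ k s‖)
  rw [hprob] at key
  have hY := S.lintegral_offspring k fun lm => ENNReal.ofReal S.Cb * (f lm.1 s * f lm.2 s)
  rw [hY] at key
  refine Eq.trans (lintegral_congr fun u => ?_) (key.trans ?_)
  · simp only [step, hte, if_false]
    split_ifs <;> simp [s]
  · simp only [hg]
    congr 2
    · rw [← mul_assoc, ENNReal.ofReal_mul S.Cf_nonneg, mul_comm (ENNReal.ofReal S.Cf)]
    · rw [← ENNReal.tsum_mul_left]
      exact tsum_congr fun lm => mul_left_comm _ _ _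

/-- The expectation of one step of the evaluation. -/
theorem lintegral_step (hγ : ∀ k, Measurable (γ k)) {F : Mode d → ℝ → Noise d → ℝ≥0∞}
    (hF : ∀ k, Measurable fun z : ℝ × Noise d => F k z.1 z.2) (k : Mode d) {t : ℝ} (ht : 0 ≤ t) :
    ∫⁻ ω, S.step χ₀ γ F k t (ω []) (fun α => ω (0 :: α)) (fun α => ω (1 :: α))
        (fun α => ω (2 :: α)) ∂S.noiseLaw =
      S.mildMap χ₀ γ (fun k s => ∫⁻ ω, F k s ω ∂S.noiseLaw) k t := by
  have hm : Measurable fun ω : Noise d => S.step χ₀ γ F k t (ω []) (fun α => ω (0 :: α))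
      (fun α => ω (1 :: α)) (fun α => ω (2 :: α)) :=
    (S.measurable_step (χ₀ := χ₀) hγ hF k).comp
      (g := fun z : ℝ × Mark d × Noise d × Noise d × Noise d => S.step χ₀ γ F k z.1 z.2.1 z.2.2.1 z.2.2.2.1 z.2.2.2.2)
      (f := fun ω : Noise d => (t, ω [], (fun α => ω (0 :: α)), (fun α => ω (1 :: α)),
        (fun α => ω (2 :: α)))) (by fun_prop)
  have hFs : ∀ k s, Measurable (F k s) := fun k s => (hF k).comp measurable_prodMk_left
  rw [S.lintegral_node hm, ← S.lintegral_step_mark hγ (fun k => (hF k).lintegral_prod_right') k ht]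
  refine lintegral_congr fun x => ?_
  change ∫⁻ ω₀, ∫⁻ ω₁, ∫⁻ ω₂, S.step χ₀ γ F k t x ω₀ ω₁ ω₂ ∂S.noiseLaw ∂S.noiseLaw ∂S.noiseLaw = _
  simp only [step]
  split_ifs
  · simp
  · simp
  · simp [lintegral_const_mul _ (hFs _ _)]
  -- Branching: `ω₁` and `ω₂` are integrated separately, so the expectation of the product is the
  -- product of the expectations.
  · simp_rw [lintegral_const_mul _ ((hFs _ _).const_mul _), lintegral_const_mul _ (hFs _ _)]
    rw [lintegral_const, measure_univ, mul_one,
      lintegral_const_mul _ ((hFs _ _).mul_const _), lintegral_mul_const _ (hFs _ _)]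
  · simp

end System

end BranchTree

/-! ### Truncated evaluations and measurability -/

namespace BranchTree

theorem evalApprox_nonneg {d : ℕ} {Cf Cb : ℝ} (hCf : 0 ≤ Cf) (hCb : 0 ≤ Cb) {init : Mode d → ℝ}
    (hinit : ∀ k, 0 ≤ init k) {force : Mode d → ℝ → ℝ} (hforce : ∀ k s, 0 ≤ force k s) (n : ℕ)
    (t : ℝ) (𝒯 : Tree d) :
    0 ≤ evalApprox Cf Cb (fun _ _ _ x y => x * y) init force n t 𝒯 := by
  induction n generalizing t 𝒯 with
  | zero => exact le_rfl
  | succ n ih =>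
    rw [evalApprox]
    split
    · exact le_rfl
    split_ifs
    · exact hinit _
    split
    · exact hforce _ _
    · exact mul_nonneg hCf (ih _ _)
    · exact mul_nonneg hCb (mul_nonneg (ih _ _) (ih _ _))
    · exact le_rfl

namespace System

variable {d r : ℕ} (S : System d r) (χ₀ : Mode d → State r) (γ : Mode d → ℝ → State r)

theorem measurable_childPos (k : Mode d) (i : Fin 3) :
    Measurable fun x : Mark d => childPos k x i := by
  unfold childPos
  split_ifs <;> fun_prop

theorem tree_death_nil (k : Mode d) (ω : Noise d) :
    (S.tree k ω).death [] = (S.lam k)⁻¹ * (ω []).1 := by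
  simp [tree, deathTime, birthTime, hatPos]

theorem childAlive_zero (k : Mode d) (x : Mark d) :
    S.childAlive k x 0 ↔ x.2.1 ∈ Icc 0 (S.p k) := by simp [childAlive]

theorem childAlive_one (k : Mode d) (x : Mark d) :
    S.childAlive k x 1 ↔ x.2.1 ∈ Icc (1 - S.qTot k) 1 := by simp [childAlive]

theorem childAlive_two (k : Mode d) (x : Mark d) :
    S.childAlive k x 2 ↔ x.2.1 ∈ Icc (1 - S.qTot k) 1 := by simp [childAlive]

/-- The evaluation of the random tree with the positive data, followed for `n` generations. -/
noncomputable def posApprox : ℕ → Mode d → ℝ → Noise d → ℝ≥0∞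
  | 0, _, _, _ => 0
  | n + 1, k, t, ω => S.step χ₀ γ (posApprox n) k t (ω []) (fun α => ω (0 :: α))
      (fun α => ω (1 :: α)) (fun α => ω (2 :: α))

theorem posApprox_eq (n : ℕ) (k : Mode d) (t : ℝ) (ω : Noise d) :
    S.posApprox χ₀ γ n k t ω = ENNReal.ofReal (evalApprox S.Cf S.Cb (fun _ _ _ x y => x * y)
      (fun k => ‖χ₀ k‖) (fun k s => ‖γ k s‖) n t (S.tree k ω)) := by
  induction n generalizing k t ω with
  | zero => simp [posApprox, evalApprox]
  | succ n ih =>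
    rw [posApprox, evalApprox_tree, step]
    simp only [tree_pos_singleton, tree_death_nil, childAlive_zero, childAlive_one, childAlive_two]
    have hn := fun t (𝒯 : Tree d) => evalApprox_nonneg S.Cf_nonneg S.Cb_nonneg
      (fun k => norm_nonneg (χ₀ k)) (fun k s => norm_nonneg (γ k s)) n t 𝒯
    by_cases ht : t ≤ (S.lam k)⁻¹ * (ω []).1
    · simp only [ht, if_true]
    by_cases h0 : (ω []).2.1 ∈ Icc 0 (S.p k) <;>
      by_cases h1 : (ω []).2.1 ∈ Icc (1 - S.qTot k) 1 <;>
      simp only [ht, h0, h1, if_true, if_false, ENNReal.ofReal_zero, smul_eq_mul]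
    · rw [ENNReal.ofReal_mul S.Cf_nonneg, S.shift_tree k ω 0 ((S.childAlive_zero _ _).2 h0), ih]
      rfl
    · rw [ENNReal.ofReal_mul S.Cb_nonneg, ENNReal.ofReal_mul (hn _ _),
        S.shift_tree k ω 1 ((S.childAlive_one _ _).2 h1),
        S.shift_tree k ω 2 ((S.childAlive_two _ _).2 h1), ih, ih]
      rfl

variable {γ} in
theorem measurable_posApprox (hγ : ∀ k, Measurable (γ k)) (n : ℕ) (k : Mode d) :
    Measurable fun z : ℝ × Noise d => S.posApprox χ₀ γ n k z.1 z.2 := by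
  induction n generalizing k with
  | zero => exact measurable_const
  | succ n ih =>
    exact (S.measurable_step (χ₀ := χ₀) hγ ih k).comp
      (g := fun z : ℝ × Mark d × Noise d × Noise d × Noise d =>
        S.step χ₀ γ (S.posApprox χ₀ γ n) k z.1 z.2.1 z.2.2.1 z.2.2.2.1 z.2.2.2.2)
      (f := fun z : ℝ × Noise d => (z.1, z.2 [], (fun α => z.2 (0 :: α)), (fun α => z.2 (1 :: α)),
        (fun α => z.2 (2 :: α)))) (by fun_prop)

theorem measurable_realised (k : Mode d) (α : Label) :
    Measurable fun ω : Noise d => S.Realised k ω α := by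
  induction α generalizing k with
  | nil => exact measurable_const
  | cons i α ih =>
    refine Measurable.and ?_ ?_
    · refine measurableSet_setOfPred.1 ?_
      unfold childAlive
      have h : Measurable fun ω : Noise d => (ω []).2.1 := by fun_prop
      split_ifs
      exacts [h measurableSet_Icc, h measurableSet_Icc]
    · have h : Measurable fun z : Mode d × Noise d => S.Realised z.1 z.2 α :=
        measurable_mode_prod ih
      exact h.comp (((measurable_childPos k i).comp (measurable_pi_apply [])).prodMk (by fun_prop))

theorem measurable_birthTime (k : Mode d) (α : Label) :
    Measurable fun ω : Noise d => S.birthTime k ω α := by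
  induction α generalizing k with
  | nil => exact measurable_const
  | cons i α ih =>
    refine Measurable.add (by fun_prop) ?_
    have h : Measurable fun z : Mode d × Noise d => S.birthTime z.1 z.2 α :=
      measurable_mode_prod ih
    exact h.comp (((measurable_childPos k i).comp (measurable_pi_apply [])).prodMk (by fun_prop))

theorem mem_born_tree (k : Mode d) (ω : Noise d) (t : ℝ) (α : Label) :
    α ∈ (S.tree k ω).born t ↔ S.Realised k ω α ∧ S.birthTime k ω α ≤ t := by
  simp [Tree.born, tree]

/-- Finiteness means being contained in some finite set of labels. There are countably many labels
and countably many such sets, so this is a countable union of countable intersections of measurable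
events. -/
theorem measurableSet_born_finite (k : Mode d) :
    MeasurableSet {z : ℝ × Noise d | ((S.tree k z.2).born z.1).Finite} := by
  have h : ∀ z : ℝ × Noise d, ((S.tree k z.2).born z.1).Finite ↔ ∃ s : Finset Label,
      ∀ α : Label, α ∈ s ∨ ¬ (S.Realised k z.2 α ∧ S.birthTime k z.2 α ≤ z.1) := by
    intro z
    simp only [← mem_born_tree]
    constructor
    · exact fun h => ⟨h.toFinset, fun α => by simpa using em _⟩
    · rintro ⟨s, hs⟩
      exact s.finite_toSet.subset fun α hα => (hs α).resolve_right (not_not.2 hα)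
  simp only [h, ofPred_exists, ofPred_forall]
  refine .iUnion fun s => .iInter fun α => measurableSet_setOfPred.2 ?_
  refine Measurable.or measurable_const (Measurable.not (Measurable.and ?_ ?_))
  · exact (S.measurable_realised k α).comp measurable_snd
  · exact measurableSet_setOfPred.1
      (measurableSet_le ((S.measurable_birthTime k α).comp measurable_snd) measurable_fst)

open Classical in
/-- A jointly measurable version of the positive evaluation of the random tree. -/
noncomputable def posEval (k : Mode d) (t : ℝ) (ω : Noise d) : ℝ≥0∞ :=
  if 0 ≤ t ∧ ((S.tree k ω).born t).Finite then
    liminf (fun n => S.posApprox χ₀ γ n k t ω) atTop else 0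

variable {γ} in
theorem measurable_posEval (hγ : ∀ k, Measurable (γ k)) (k : Mode d) :
    Measurable fun z : ℝ × Noise d => S.posEval χ₀ γ k z.1 z.2 :=
  Measurable.ite ((measurableSet_le measurable_const measurable_fst).inter
      (S.measurableSet_born_finite k))
    (Measurable.liminf fun n => S.measurable_posApprox χ₀ hγ n k) measurable_const

theorem posEval_eq (k : Mode d) {t : ℝ} (ht : 0 ≤ t) (ω : Noise d) :
    S.posEval χ₀ γ k t ω = ENNReal.ofReal (S.Rpos χ₀ γ t (S.tree k ω)) := by
  by_cases hf : ((S.tree k ω).born t).Finite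
  · rw [posEval, if_pos ⟨ht, hf⟩]
    refine Tendsto.liminf_eq (tendsto_const_nhds.congr' ?_)
    -- The truncations are constant in `n` once `n` reaches the number of particles born in `[0,
    -- t]`.
    filter_upwards [eventually_ge_atTop ((S.tree k ω).born t).ncard] with n hn
    rw [posApprox_eq, S.evalApprox_eq_eval _ _ _ _ _ n k ω t ht hf hn, Rpos]
  · simp [posEval, Rpos, eval, hf]

theorem posEval_le (k : Mode d) (t : ℝ) (ω : Noise d) :
    S.posEval χ₀ γ k t ω ≤ liminf (fun n => S.posApprox χ₀ γ n k t ω) atTop := by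
  unfold posEval
  split_ifs
  exacts [le_rfl, zero_le]

theorem expRpos_eq (k : Mode d) {t : ℝ} (ht : 0 ≤ t) :
    S.expRpos χ₀ γ k t = ∫⁻ ω, S.posEval χ₀ γ k t ω ∂S.noiseLaw :=
  lintegral_congr fun ω => (S.posEval_eq χ₀ γ k ht ω).symm

/-! ### The almost sure recursion at the root -/

theorem birthTime_nonneg (k : Mode d) {ω : Noise d} (hω : ∀ α, 0 ≤ (ω α).1) (α : Label) :
    0 ≤ S.birthTime k ω α := by
  induction α generalizing k ω with
  | nil => exact le_rfl
  | cons i α ih =>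
    exact add_nonneg (mul_nonneg (inv_nonneg.2 (S.lam_pos k).le) (hω [])) (ih _ fun β => hω _)

/-- A tree with finitely many particles in each of the subtrees of the children of the root
has finitely many particles. -/
theorem born_finite_of_children (k : Mode d) (ω : Noise d) (t : ℝ)
    (h : ∀ i, S.childAlive k (ω []) i →
      ((S.tree (childPos k (ω []) i) (fun β => ω (i :: β))).born
        (t - (S.lam k)⁻¹ * (ω []).1)).Finite) :
    ((S.tree k ω).born t).Finite := by
  have hfin : ∀ i, {α : Label | i :: α ∈ (S.tree k ω).born t}.Finite := by
    intro i
    by_cases hi : S.childAlive k (ω []) i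
    · refine (h i hi).subset fun α hα => ?_
      rw [mem_ofPred_eq, mem_born_tree] at hα
      rw [mem_born_tree]
      exact ⟨hα.1.2, by have := hα.2; rw [birthTime] at this; linarith⟩
    · refine finite_empty.subset fun α hα => hi ?_
      rw [mem_ofPred_eq, mem_born_tree] at hα
      exact hα.1.1
  refine ((finite_singleton ([] : Label)).union
    (finite_iUnion fun i => (hfin i).image (List.cons i))).subset fun α hα => ?_
  match α with
  | [] => exact .inl rfl
  | i :: α => exact .inr (mem_iUnion.2 ⟨i, α, hα, rfl⟩)

theorem posEval_of_infinite {k : Mode d} {t : ℝ} {ω : Noise d}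
    (h : ¬ ((S.tree k ω).born t).Finite) : S.posEval χ₀ γ k t ω = 0 :=
  if_neg fun h' => h h'.2

/-- The recursion at the root for the positive evaluation. -/
theorem posEval_eq_step (k : Mode d) {t : ℝ} (ht : 0 ≤ t) {ω : Noise d} (hω : ∀ α, 0 ≤ (ω α).1)
    (hne : t ≠ (S.lam k)⁻¹ * (ω []).1) :
    S.posEval χ₀ γ k t ω = S.step χ₀ γ (S.posEval χ₀ γ) k t (ω []) (fun α => ω (0 :: α))
      (fun α => ω (1 :: α)) (fun α => ω (2 :: α)) := by
  by_cases hf : ((S.tree k ω).born t).Finite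
  · rw [posEval_eq _ _ _ _ ht, Rpos, S.eval_tree _ _ _ _ _ k ω t ht hf, step]
    simp only [tree_pos_singleton, tree_death_nil, childAlive_zero, childAlive_one, childAlive_two]
    by_cases htτ : t ≤ (S.lam k)⁻¹ * (ω []).1
    · simp only [htτ, if_true]
    have hs : 0 ≤ t - (S.lam k)⁻¹ * (ω []).1 := by linarith
    have hnn : ∀ i, S.childAlive k (ω []) i →
        0 ≤ S.Rpos χ₀ γ (t - (S.lam k)⁻¹ * (ω []).1) ((S.tree k ω).shift i) := by
      intro i hi
      have hb := (S.born_shift k ω i t ht hf).1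
      rw [tree_death_nil] at hb
      rw [Rpos, eval, if_pos hb]
      exact evalApprox_nonneg S.Cf_nonneg S.Cb_nonneg
        (fun k => norm_nonneg (χ₀ k)) (fun k s => norm_nonneg (γ k s)) _ _ _
    by_cases h0 : (ω []).2.1 ∈ Icc 0 (S.p k) <;>
      by_cases h1 : (ω []).2.1 ∈ Icc (1 - S.qTot k) 1 <;>
      simp only [htτ, h0, h1, if_true, if_false, ENNReal.ofReal_zero, smul_eq_mul]
    · rw [ENNReal.ofReal_mul S.Cf_nonneg, S.shift_tree k ω 0 ((S.childAlive_zero _ _).2 h0),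
        posEval_eq _ _ _ _ hs]
      rfl
    · have h1' := (S.childAlive_one k (ω [])).2 h1
      have h2' := (S.childAlive_two k (ω [])).2 h1
      have hn1 := hnn 1 h1'
      rw [Rpos] at hn1
      rw [ENNReal.ofReal_mul S.Cb_nonneg, ENNReal.ofReal_mul hn1, S.shift_tree k ω 1 h1',
        S.shift_tree k ω 2 h2', posEval_eq _ _ _ _ hs, posEval_eq _ _ _ _ hs]
      rfl
  -- With infinitely many births the left-hand side is 0, so the step has to vanish as well.
  · rw [posEval_of_infinite _ _ _ hf, step]
    -- If the root died strictly after `t`, no child would be born by time `t` and the tree would be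
    -- finite. Equality must be excluded: children born exactly at `t` are counted in `born t`,
    -- while the step still returns the initial condition.
    have hτ : ¬ t ≤ (S.lam k)⁻¹ * (ω []).1 := by
      refine fun hle => hf (S.born_finite_of_children k ω t fun i _ => ?_)
      refine finite_empty.subset fun α hα => ?_
      rw [mem_born_tree] at hα
      have := S.birthTime_nonneg (childPos k (ω []) i) (ω := fun β => ω (i :: β))
        (fun β => hω _) α
      exact hne (le_antisymm hle (by linarith [hα.2]))
    rw [if_neg hτ]
    -- An infinite tree has a realised child with an infinite subtree. The evaluation of that
    -- subtree is 0 and enters the step as a factor.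
    by_contra hstep
    refine hf (S.born_finite_of_children k ω t fun i hi => ?_)
    by_contra hinf
    have hz := S.posEval_of_infinite χ₀ γ hinf
    refine hstep (Eq.symm ?_)
    fin_cases i
    · have h0 := (S.childAlive_zero k (ω [])).1 hi
      have hz' : S.posEval χ₀ γ k (t - (S.lam k)⁻¹ * (ω []).1) (fun α => ω (0 :: α)) = 0 := hz
      rw [if_pos h0, hz', mul_zero, ite_self]
    · have h1 := (S.childAlive_one k (ω [])).1 hi
      have hz' : S.posEval χ₀ γ ((ω []).2.2 k).1 (t - (S.lam k)⁻¹ * (ω []).1)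
        (fun α => ω (1 :: α)) = 0 := hz
      rw [if_pos h1, if_pos h1, hz', zero_mul, mul_zero, ite_self]
    · have h1 := (S.childAlive_two k (ω [])).1 hi
      have hz' : S.posEval χ₀ γ ((ω []).2.2 k).2 (t - (S.lam k)⁻¹ * (ω []).1)
        (fun α => ω (2 :: α)) = 0 := hz
      rw [if_pos h1, if_pos h1, hz', mul_zero, mul_zero, ite_self]

theorem ae_noise_lifetime {P : ℝ → Prop} (hP : ∀ᵐ e ∂(expMeasure 1), P e) (α : Label) :
    ∀ᵐ ω ∂S.noiseLaw, P (ω α).1 := by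
  have h1 : ∀ᵐ x ∂S.markLaw, P x.1 := Measure.quasiMeasurePreserving_fst.ae hP
  exact (measurePreserving_eval_infinitePi (fun _ : Label => S.markLaw) α).quasiMeasurePreserving.ae
    h1

theorem ae_lifetime_nonneg : ∀ᵐ ω ∂S.noiseLaw, ∀ α, 0 ≤ (ω α).1 := by
  refine ae_all_iff.2 fun α => S.ae_noise_lifetime (P := fun e => 0 ≤ e) ?_ α
  have h : expMeasure 1 (Iio 0) = 0 := by
    rw [show expMeasure 1 = volume.withDensity (exponentialPDF 1) from rfl,
      withDensity_apply _ measurableSet_Iio, lintegral_exponentialPDF_of_nonpos le_rfl]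
  filter_upwards [measure_eq_zero_iff_ae_notMem.1 h] with e he
  exact not_lt.1 he

theorem ae_ne_rootDeath (k : Mode d) (t : ℝ) :
    ∀ᵐ ω ∂S.noiseLaw, t ≠ (S.lam k)⁻¹ * (ω []).1 := by
  refine S.ae_noise_lifetime (P := fun e => t ≠ (S.lam k)⁻¹ * e) ?_ []
  have : expMeasure 1 ≪ volume := withDensity_absolutelyContinuous _ _
  filter_upwards [this.ae_le (Measure.ae_ne volume (S.lam k * t))] with e he h
  exact he (by rw [h, mul_inv_cancel_left₀ (S.lam_pos k).ne'])

/-! ### The expectation as the minimal mild solution -/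

variable {γ}

/-- The integral of `posEval` stands on the right because it is measurable on the whole real line,
as the continuity argument requires; it is identified with `expRpos` only for non-negative times. -/
theorem expRpos_eq_mildMap_posEval (hγ : ∀ k, Measurable (γ k)) (k : Mode d) {t : ℝ}
    (ht : 0 ≤ t) :
    S.expRpos χ₀ γ k t =
      S.mildMap χ₀ γ (fun k s => ∫⁻ ω, S.posEval χ₀ γ k s ω ∂S.noiseLaw) k t := by
  rw [← S.lintegral_step hγ (S.measurable_posEval χ₀ hγ) k ht, expRpos_eq _ _ _ _ ht]
  refine lintegral_congr_ae ?_
  filter_upwards [S.ae_lifetime_nonneg, S.ae_ne_rootDeath k t] with ω h1 h2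
  exact S.posEval_eq_step χ₀ γ k ht h1 h2

/-- The expectation of the positive evaluation solves the comparison system in mild form. -/
theorem expRpos_eq_mildMap (hγ : ∀ k, Measurable (γ k)) (k : Mode d) {t : ℝ} (ht : 0 ≤ t) :
    S.expRpos χ₀ γ k t = S.mildMap χ₀ γ (S.expRpos χ₀ γ) k t :=
  (S.expRpos_eq_mildMap_posEval χ₀ hγ k ht).trans <| le_antisymm
    (S.mildMap_mono χ₀ γ ⟨ht, le_rfl⟩ (fun k _ hs => (S.expRpos_eq χ₀ γ k hs.1).ge) k)
    (S.mildMap_mono χ₀ γ ⟨ht, le_rfl⟩ (fun k _ hs => (S.expRpos_eq χ₀ γ k hs.1).le) k)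

theorem isMildComparison_expRpos (hγ : ∀ k, Measurable (γ k)) (T : ℝ) :
    S.IsMildComparison χ₀ γ T (S.expRpos χ₀ γ) := by
  refine fun k => ⟨?_, fun t ht => S.expRpos_eq_mildMap χ₀ hγ k ht.1⟩
  have h : (fun t : Icc 0 T => S.expRpos χ₀ γ k t) =
      fun t : Icc 0 T => ∫⁻ ω, S.posEval χ₀ γ k t ω ∂S.noiseLaw :=
    funext fun t => S.expRpos_eq χ₀ γ k t.2.1
  rw [h]
  exact (S.measurable_posEval χ₀ hγ k).lintegral_prod_right'.comp measurable_subtype_coe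

/-- The expectation of the positive evaluation is below every non-negative mild solution. -/
theorem expRpos_le (hγ : ∀ k, Measurable (γ k)) {T : ℝ} {v : Mode d → ℝ → ℝ≥0∞}
    (hv : S.IsMildComparison χ₀ γ T v) (k : Mode d) {t : ℝ} (ht : t ∈ Icc 0 T) :
    S.expRpos χ₀ γ k t ≤ v k t := by
  -- Picard iteration from 0: if the `n`-th iterate is below `v`, monotonicity of `mildMap` puts the
  -- next one below `mildMap v = v`.
  have hn : ∀ n k, ∀ t ∈ Icc 0 T, ∫⁻ ω, S.posApprox χ₀ γ n k t ω ∂S.noiseLaw ≤ v k t := by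
    intro n
    induction n with
    | zero => simp [posApprox]
    | succ n ih =>
      intro k t ht
      refine (S.lintegral_step hγ (S.measurable_posApprox χ₀ hγ n) k ht.1).trans_le ?_
      exact (S.mildMap_mono χ₀ γ ht ih k).trans_eq ((hv k).2 t ht).symm
  rw [expRpos_eq _ _ _ _ ht.1]
  calc ∫⁻ ω, S.posEval χ₀ γ k t ω ∂S.noiseLaw
      ≤ ∫⁻ ω, liminf (fun n => S.posApprox χ₀ γ n k t ω) atTop ∂S.noiseLaw :=
        lintegral_mono fun ω => S.posEval_le χ₀ γ k t ω
    _ ≤ liminf (fun n => ∫⁻ ω, S.posApprox χ₀ γ n k t ω ∂S.noiseLaw) atTop :=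
        lintegral_liminf_le fun n => (S.measurable_posApprox χ₀ hγ n k).comp measurable_prodMk_left
    _ ≤ liminf (fun _ : ℕ => v k t) atTop :=
        liminf_le_liminf (.of_forall fun n => hn n k t ht)
    _ = v k t := liminf_const _

/-! ### Continuity in time -/

/-- The right-hand side of the mild formulation is continuous in time if it is finite. -/
theorem continuousOn_mildMap (hγ : ∀ k, Measurable (γ k)) {u : Mode d → ℝ → ℝ≥0∞}
    (hu : ∀ k, Measurable (u k)) (k : Mode d) {T : ℝ} (hfin : S.mildMap χ₀ γ u k T ≠ ∞) :
    ContinuousOn (fun t => (S.mildMap χ₀ γ u k t).toReal) (Icc 0 T) := by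
  set g : ℝ → ℝ≥0∞ := fun s => ENNReal.ofReal (S.Cf * S.p k) * u k s +
        ENNReal.ofReal S.Cb * (∑' lm : Mode d × Mode d,
          ENNReal.ofReal (S.q k lm.1 lm.2) * (u lm.1 s * u lm.2 s)) +
        ENNReal.ofReal (S.dd k) * ENNReal.ofReal ‖γ k s‖ with hg
  have hγk := hγ k
  have hgm : Measurable g := by
    refine (((hu k).const_mul _).add (Measurable.const_mul ?_ _)).add (by fun_prop)
    exact Measurable.tsum fun lm => ((hu _).mul (hu _)).const_mul _
  -- Splitting `exp (-lam * (t - s))` moves the dependence on `t` out of the integrand, so that only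
  -- a primitive of the fixed function `h` remains.
  set h : ℝ → ℝ≥0∞ := fun s => ENNReal.ofReal (S.lam k * Real.exp (S.lam k * s)) * g s with hh
  have hhm : Measurable h := by fun_prop
  have hmap : ∀ t, S.mildMap χ₀ γ u k t = ENNReal.ofReal (Real.exp (-S.lam k * t)) *
      (ENNReal.ofReal ‖χ₀ k‖ + ∫⁻ s in Icc 0 t, h s) := by
    intro t
    rw [mul_add, ← lintegral_const_mul _ hhm, mildMap]
    congr 1
    refine lintegral_congr fun s => ?_
    rw [hh, ← mul_assoc, ← ENNReal.ofReal_mul (Real.exp_pos _).le]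
    congr 2
    rw [mul_left_comm, ← Real.exp_add]
    ring_nf
  -- The exponential prefactor is positive, so finiteness of the mild formula at the endpoint `T`
  -- alone makes `h` integrable on all of `[0, T]`.
  have hT : ∫⁻ s in Icc 0 T, h s ≠ ∞ := by
    intro htop
    refine hfin ?_
    rw [hmap, htop, add_top, ENNReal.mul_top]
    simpa using Real.exp_pos _
  have hint : IntegrableOn (fun s => (h s).toReal) (Icc 0 T) :=
    integrable_toReal_of_lintegral_ne_top hhm.aemeasurable hT
  have hprim : ContinuousOn (fun t => ∫ s in Icc 0 t, (h s).toReal) (Icc 0 T) :=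
    intervalIntegral.continuousOn_primitive_Icc hint
  have hcont : ContinuousOn (fun t => Real.exp (-S.lam k * t) *
      (‖χ₀ k‖ + ∫ s in Icc 0 t, (h s).toReal)) (Icc 0 T) :=
    ContinuousOn.mul (by fun_prop) (continuousOn_const.add hprim)
  refine hcont.congr fun t ht => ?_
  have ht' : ∫⁻ s in Icc 0 t, h s ≠ ∞ :=
    ne_top_of_le_ne_top hT (lintegral_mono_set (Icc_subset_Icc le_rfl ht.2))
  simp only
  rw [hmap, ENNReal.toReal_mul, ENNReal.toReal_ofReal (Real.exp_pos _).le,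
    ENNReal.toReal_add ENNReal.ofReal_ne_top ht', ENNReal.toReal_ofReal (norm_nonneg _),
    integral_toReal hhm.aemeasurable (ae_lt_top hhm ht')]

/-- The expectation of the positive evaluation is continuous in time as long as it is finite. -/
theorem continuousOn_expRpos (hγ : ∀ k, Measurable (γ k)) (k : Mode d) {T : ℝ} (hT : 0 ≤ T)
    (hfin : S.expRpos χ₀ γ k T < ∞) :
    ContinuousOn (fun t => (S.expRpos χ₀ γ k t).toReal) (Icc 0 T) := by
  have h := fun t (ht : 0 ≤ t) => S.expRpos_eq_mildMap_posEval χ₀ hγ k ht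
  refine (S.continuousOn_mildMap χ₀ hγ
    (fun k => (S.measurable_posEval χ₀ hγ k).lintegral_prod_right') k
    (h T hT ▸ hfin.ne)).congr fun t ht => ?_
  exact congrArg ENNReal.toReal (h t ht.1)

/-! ### Pathwise comparison of the two evaluations -/

theorem norm_evalApprox_le (n : ℕ) (t : ℝ) (𝒯 : Tree d) :
    ‖evalApprox S.Cf S.Cb (fun k l m x y => S.B k l m x y) χ₀ γ n t 𝒯‖ ≤
      evalApprox S.Cf S.Cb (fun _ _ _ x y => x * y) (fun k => ‖χ₀ k‖) (fun k s => ‖γ k s‖)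
        n t 𝒯 := by
  induction n generalizing t 𝒯 with
  | zero => simp [evalApprox]
  | succ n ih =>
    simp only [evalApprox]
    split
    · simp
    split_ifs
    · exact le_rfl
    split
    · exact le_rfl
    · rw [norm_smul, Real.norm_of_nonneg S.Cf_nonneg]
      exact mul_le_mul_of_nonneg_left (ih _ _) S.Cf_nonneg
    · rw [norm_smul, Real.norm_of_nonneg S.Cb_nonneg]
      refine mul_le_mul_of_nonneg_left ((S.norm_B_le _ _ _ _ _).trans ?_) S.Cb_nonneg
      exact mul_le_mul (ih _ _) (ih _ _) (norm_nonneg _) ((norm_nonneg _).trans (ih _ _))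
    · simp

theorem norm_evalApprox_eq (hB : ∀ k l m x y, ‖S.B k l m x y‖ = ‖x‖ * ‖y‖) (n : ℕ) (t : ℝ)
    (𝒯 : Tree d) :
    ‖evalApprox S.Cf S.Cb (fun k l m x y => S.B k l m x y) χ₀ γ n t 𝒯‖ =
      evalApprox S.Cf S.Cb (fun _ _ _ x y => x * y) (fun k => ‖χ₀ k‖) (fun k s => ‖γ k s‖)
        n t 𝒯 := by
  induction n generalizing t 𝒯 with
  | zero => simp [evalApprox]
  | succ n ih =>
    simp only [evalApprox]
    split
    · simp
    split_ifs
    · rfl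
    split
    · rfl
    · rw [norm_smul, Real.norm_of_nonneg S.Cf_nonneg, ih, smul_eq_mul]
    · rw [norm_smul, Real.norm_of_nonneg S.Cb_nonneg, hB, ih, ih, smul_eq_mul]
    · simp

/-- Both evaluations follow the same tree for the same number of generations, and both are 0 if
infinitely many particles are born, so the bound for the truncations applies directly. -/
theorem norm_R_le (t : ℝ) (𝒯 : Tree d) : ‖S.R χ₀ γ t 𝒯‖ ≤ S.Rpos χ₀ γ t 𝒯 := by
  unfold R Rpos eval
  split_ifs
  · exact S.norm_evalApprox_le χ₀ _ _ _
  · simp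

theorem norm_R_eq (hB : ∀ k l m x y, ‖S.B k l m x y‖ = ‖x‖ * ‖y‖) (t : ℝ) (𝒯 : Tree d) :
    ‖S.R χ₀ γ t 𝒯‖ = S.Rpos χ₀ γ t 𝒯 := by
  unfold R Rpos eval
  split_ifs
  · exact S.norm_evalApprox_eq χ₀ hB _ _ _
  · simp

end System

end BranchTree

theorem theorem4p1 {d r : ℕ} (S : BranchTree.System d r)
    (χ₀ : BranchTree.Mode d → BranchTree.State r)
    (γ : BranchTree.Mode d → ℝ → BranchTree.State r) (hγ : ∀ k, Measurable (γ k))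
    (T : ℝ) (hT : 0 ≤ T) :
    ((∀ k, ∀ t ∈ Set.Icc 0 T, S.expRpos χ₀ γ k t < ∞) →
      S.IsMildComparison χ₀ γ T (S.expRpos χ₀ γ) ∧
      ∀ k, ContinuousOn (fun t => (S.expRpos χ₀ γ k t).toReal) (Set.Icc 0 T)) ∧
    ((∃ u : BranchTree.Mode d → ℝ → ℝ≥0∞, S.IsMildComparison χ₀ γ T u ∧
        ∀ k, ∀ t ∈ Set.Icc 0 T, u k t < ∞) →
      (∀ k, ∀ t ∈ Set.Icc 0 T, S.expRpos χ₀ γ k t < ∞) ∧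
      S.IsMildComparison χ₀ γ T (S.expRpos χ₀ γ) ∧
      ∀ v : BranchTree.Mode d → ℝ → ℝ≥0∞, S.IsMildComparison χ₀ γ T v →
        ∀ k, ∀ t ∈ Set.Icc 0 T, S.expRpos χ₀ γ k t ≤ v k t) ∧
    ((∀ k t, 0 ≤ t → S.expNormR χ₀ γ k t ≤ S.expRpos χ₀ γ k t) ∧
      ((∀ k l m x y, ‖S.B k l m x y‖ = ‖x‖ * ‖y‖) →
        ∀ k t, 0 ≤ t → S.expNormR χ₀ γ k t = S.expRpos χ₀ γ k t)) := by
  have hsol := S.isMildComparison_expRpos χ₀ hγ T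
  refine ⟨fun hfin => ⟨hsol, fun k =>
    S.continuousOn_expRpos χ₀ hγ k hT (hfin k T ⟨hT, le_rfl⟩)⟩, ?_, ?_, ?_⟩
  · rintro ⟨u, hu, hfin⟩
    exact ⟨fun k t ht => (S.expRpos_le χ₀ hγ hu k ht).trans_lt (hfin k t ht), hsol,
      fun v hv k t ht => S.expRpos_le χ₀ hγ hv k ht⟩
  · exact fun k t _ => lintegral_mono fun ω => ENNReal.ofReal_le_ofReal (S.norm_R_le χ₀ _ _)
  · exact fun hB k t _ => lintegral_congr fun ω =>
      congrArg ENNReal.ofReal (S.norm_R_eq χ₀ hB _ _)
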